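/- There are universal constants $c_1,c_2>0$ with the following property. Let $d\ge 1$, $p\ge 0$, let $T\ge 1$, let $0=t_0<t_1<\dots<t_N=T$ be any finite set of observation times, and let $\phi$ be any (possibly randomized, measurable) estimator that maps a tuple of observed states $(x_0,\dots,x_N)\in(\mathbb{R}^d)^{N+1}$ to a (random) matrix in $\mathbb{R}^{d\times d}$, the randomization being independent of everything else given the observed states. Then there are $A\in\mathbb{R}^{d\times d}$ and $B\in\mathbb{R}^{d\times p}$, where $A$ is stable (all its eigenvalues have negative real part), $A$ is one of the two matrices $$-I_d\qquad\text{and}\qquad -I_d-\tfrac{1}{5\sqrt T}\,E_{11}$$ ($E_{11}$ is the matrix whose only nonzero entry is a $1$ at position $(1,1)$), and $B=0$, such that for every process $X$ in $\mathbb{R}^d$ that solves $$dX_t=AX_t\,dt+BU_t\,dt+dW_t,\qquad X_0=0,$$ with a standard $d$-dimensional Brownian motion $W$ and a non-anticipating, locally integrable control $U$, $$\mathbb{P}\left[\ \big\|\phi(X_{t_0},X_{t_1},\dots,X_{t_N})-A\big\|\ \ge\ \frac{c_1}{\sqrt T}\ \right]\ \ge\ c_2 ,$$ where $\|\cdot\|$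 is the spectral norm and the probability is over the noise and the randomization of $\phi$. In particular $c_1,c_2$ do not depend on $d$, $T$, $N$, the observation times or the estimator. -/

import Mathlib

open MeasureTheory ProbabilityTheory
open scoped NNReal ENNReal

-- From here on, the norm of a matrix is its spectral norm (the operator norm for the
-- Euclidean norms).
open scoped Matrix.Norms.L2Operator

noncomputable section

/-- Matrices carry the product `σ`-algebra of their entries. -/
instance instMeasurableSpaceRealMatrix (m n : ℕ) : MeasurableSpace (Matrix (Fin m) (Fin n) ℝ) :=
  inferInstanceAs (MeasurableSpace (Fin m → Fin n → ℝ))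

/-- A square real matrix is stable if all its complex eigenvalues have negative real part. -/
def IsStableMatrix {d : ℕ} (A : Matrix (Fin d) (Fin d) ℝ) : Prop :=
  ∀ z ∈ spectrum ℂ (A.map (algebraMap ℝ ℂ)), z.re < 0

/-- `W` is a standard `d`-dimensional Brownian motion with respect to the filtration `𝓕`:
its coordinates are independent standard real Brownian motions (started at `0`), it is adapted,
and its increments after time `s` are independent of `𝓕 s`. -/
structure IsBrownianMotion {Ω : Type*} {mΩ : MeasurableSpace Ω} {d : ℕ}
    (P : Measure Ω) (𝓕 : Filtration ℝ≥0 mΩ) (W : ℝ≥0 → Ω → EuclideanSpace ℝ (Fin d)) :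
    Prop where
  adapted : Adapted 𝓕 W
  coord : ∀ i : Fin d, IsBrownianReal (fun t ω => W t ω i) P
  indep_coord : iIndepFun (fun (i : Fin d) ω (t : ℝ≥0) => W t ω i) P
  indep_increments : ∀ s t : ℝ≥0, s ≤ t →
    Indep (MeasurableSpace.comap (fun ω => W t ω - W s ω) inferInstance) (𝓕 s) P

/-- `X` is the state process of the controlled linear system
`dX_t = A X_t dt + B U_t dt + dW_t`, `X_0 = 0`, driven by the standard Brownian motion `W`
under the (non-anticipating) control `U`. As the noise is additive, the equation means
`X_t = ∫_0^t (A X_s + B U_s) ds + W_t` for all `t ≥ 0`, almost surely. -/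
structure IsLinearSystem {Ω : Type*} {mΩ : MeasurableSpace Ω} {d p : ℕ}
    (A : Matrix (Fin d) (Fin d) ℝ) (B : Matrix (Fin d) (Fin p) ℝ)
    (P : Measure Ω) (𝓕 : Filtration ℝ≥0 mΩ)
    (W : ℝ≥0 → Ω → EuclideanSpace ℝ (Fin d))
    (U : ℝ≥0 → Ω → EuclideanSpace ℝ (Fin p))
    (X : ℝ≥0 → Ω → EuclideanSpace ℝ (Fin d)) : Prop where
  noise : IsBrownianMotion P 𝓕 W
  control_progressive : IsProgressive 𝓕 U
  control_integrable : ∀ᵐ ω ∂P, ∀ t : ℝ≥0,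
    IntervalIntegrable (fun s : ℝ => U s.toNNReal ω) volume 0 t
  state_adapted : Adapted 𝓕 X
  state_continuous : ∀ᵐ ω ∂P, Continuous fun t => X t ω
  equation : ∀ᵐ ω ∂P, ∀ t : ℝ≥0,
    X t ω = (∫ s in (0 : ℝ)..t, (Matrix.toEuclideanLin A (X s.toNNReal ω) +
      Matrix.toEuclideanLin B (U s.toNNReal ω))) + W t ω

/-- The law of the output of the randomized estimator `φ` (a Markov kernel from tuples of
observed states to matrices) when it is fed with the states of `X` at the times
`t 0, …, t N`. -/
def estimateLaw {Ω : Type*} {mΩ : MeasurableSpace Ω} {d N : ℕ}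
    (φ : Kernel (Fin (N + 1) → EuclideanSpace ℝ (Fin d)) (Matrix (Fin d) (Fin d) ℝ))
    (P : Measure Ω) (X : ℝ≥0 → Ω → EuclideanSpace ℝ (Fin d)) (t : Fin (N + 1) → ℝ≥0) :
    Measure (Matrix (Fin d) (Fin d) ℝ) :=
  (P.map fun ω i => X (t i) ω).bind φ

end

/-!
The bound is Le Cam's two-point method for the matrices `-1` and `-1 - δ E₁₁` with
`δ = 1 / (5 √T)`. These are at distance `δ`, so no estimate is within `δ / 2` of both. It remains
to see that the laws of the observed states under the two matrices overlap by a constant amount.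

*The law of the observations.* With a diagonal drift matrix the coordinates of `X` are independent
Ornstein-Uhlenbeck processes `dx = -a x dt + dw`. The innovation `x_t - e^{-a (t - s)} x_s` is the
Wiener integral `∫_s^t e^{-a (t - u)} dw_u`. No stochastic calculus is needed: by the equation, the
Riemann sums of this integral converge to the innovation on every continuous path
(`tendsto_wienerSum`); being combinations of increments of `w` over disjoint intervals, they are
independent centred Gaussian variables (`IsPreBrownianReal.map_wienerSum`); and their variances
converge to `(1 - e^{-2 a h}) / (2 a)`. So the innovations are independent Gaussian variables
(`IsLinearSystem.map_innovation`). This determines the law of the observed states, whatever the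
underlying probability space (`IsLinearSystem.map_observations`).

*The overlap.* The map from paths to innovations is linear, with determinant one. Hence both laws
of the first coordinate have explicit Lebesgue densities, with a likelihood ratio `L`; the other
coordinates have the same law in both cases. The expectation of `log L` is a sum over the time
steps. A step of length `h` contributes at least `-(3/2) δ² h` (`step_log_ratio_ge`), because the
second moment of the process is at most `1/2`, so the total is at least `-(3/2) δ² T = -3/50`,
however many observations there are. By the pointwise inequality
`log L ≤ (3/2) min(1, L) + L/2 - 3/2` the overlap `∫ min(1, L)` is then at least `1/2`
(`half_le_integral_min_one`). So the two failure probabilities add up to at least `1/2`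
(`lintegral_min_one_le`), and one of them is at least `1/4`.
-/

section

open Filter Topology

/-! ### Riemann sums of Wiener integrals -/

/-- The point number `k` of the uniform grid with `n` steps on `[s, t]`. -/
noncomputable def gridPoint (s t : ℝ) (n k : ℕ) : ℝ := s + (t - s) * (k / n)

/-- The Riemann sum of the Wiener integral `∫_s^t e^{-a (t - u)} dw_u` over the uniform grid with
`n` steps, with the integrand evaluated at the right end of each step. -/
noncomputable def wienerSum (a s t : ℝ) (w : ℝ → ℝ) (n : ℕ) : ℝ :=
  ∑ k ∈ Finset.range n, Real.exp (-a * (t - gridPoint s t n (k + 1))) *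
    (w (gridPoint s t n (k + 1)) - w (gridPoint s t n k))

lemma gridPoint_succ (s t : ℝ) (n k : ℕ) :
    gridPoint s t n (k + 1) = gridPoint s t n k + (t - s) / n := by
  simp only [gridPoint]; push_cast; ring

lemma gridPoint_mem_Icc {s t : ℝ} (hst : s ≤ t) {n k : ℕ} (hk : k ≤ n) :
    gridPoint s t n k ∈ Set.Icc s t := by
  have h0 : (0 : ℝ) ≤ k / n := by positivity
  have h1 : (k / n : ℝ) ≤ 1 := div_le_one_of_le₀ (by exact_mod_cast hk) (by positivity)
  constructor <;> simp only [gridPoint] <;> nlinarith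

lemma gridPoint_mono {s t : ℝ} (hst : s ≤ t) (n : ℕ) : Monotone (gridPoint s t n) := by
  refine monotone_nat_of_le_succ fun k => ?_
  rw [gridPoint_succ]
  have : 0 ≤ (t - s) / n := div_nonneg (by linarith) (by positivity)
  linarith

lemma exp_neg_sub_one_add_bound {y : ℝ} (hy : 0 ≤ y) :
    |y - 1 + Real.exp (-y)| ≤ y ^ 2 := by
  have h1 := Real.add_one_le_exp (-y)
  rw [abs_of_nonneg (by linarith)]
  have h2 := Real.add_one_le_exp y
  have h3 : Real.exp (-y) ≤ 1 / (1 + y) := by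
    rw [Real.exp_neg, ← one_div]
    exact one_div_le_one_div_of_le (by linarith) (by linarith)
  have h4 : 1 / (1 + y) ≤ 1 - y + y ^ 2 := by
    rw [div_le_iff₀ (by linarith)]; nlinarith [pow_nonneg hy 3]
  linarith

/-- If `x` solves `dx = -a x du + dw` on `[s, t]`, the Riemann sums of `∫_s^t e^{-a (t - u)} dw_u`
converge to the innovation `x_t - e^{-a (t - s)} x_s`. -/
theorem tendsto_wienerSum {a s t : ℝ} (ha : 0 ≤ a) (hst : s ≤ t) {x w : ℝ → ℝ}
    (hx : Continuous x)
    (hw : ∀ u ∈ Set.Icc s t, ∀ v ∈ Set.Icc s t,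
      w v - w u = x v - x u + a * ∫ r in u..v, x r) :
    Tendsto (wienerSum a s t w) atTop (𝓝 (x t - Real.exp (-a * (t - s)) * x s)) := by
  obtain ⟨M, hM⟩ := isCompact_Icc.exists_bound_of_continuousOn (s := Set.Icc s t) hx.continuousOn
  have hM0 : 0 ≤ M := (norm_nonneg _).trans (hM s ⟨le_rfl, hst⟩)
  have huc := isCompact_Icc.uniformContinuousOn_of_continuous (s := Set.Icc s t) hx.continuousOn
  rw [Metric.tendsto_atTop]
  intro ε hε
  set L := t - s with hL
  have hL0 : 0 ≤ L := by linarith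
  set ε' := ε / (2 * (a * L + 1)) with hε'
  have haL : 0 ≤ a * L := by positivity
  have hε'0 : 0 < ε' := by positivity
  obtain ⟨δ, hδ, hδx⟩ := Metric.uniformContinuousOn_iff.1 huc ε' hε'0
  have hlim : Tendsto (fun n : ℕ => L / n) atTop (𝓝 0) := tendsto_const_div_atTop_nhds_zero_nat L
  have hlim2 : Tendsto (fun n : ℕ => a ^ 2 * L * M * (L / n)) atTop (𝓝 0) := by
    simpa using hlim.const_mul (a ^ 2 * L * M)
  obtain ⟨n₀, hn₀⟩ := eventually_atTop.1 ((hlim.eventually (gt_mem_nhds hδ)).and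
    ((hlim2.eventually (gt_mem_nhds (half_pos hε))).and (eventually_gt_atTop 0)))
  refine ⟨n₀, fun n hn => ?_⟩
  obtain ⟨h1, h2, h3⟩ := hn₀ n hn
  have hn0 : (0 : ℝ) < n := by exact_mod_cast h3
  set η := L / n with hη
  have hη0 : 0 ≤ η := by positivity
  set p := gridPoint s t n with hp
  have hps : ∀ k, p (k + 1) = p k + η := fun k => gridPoint_succ s t n k
  -- The innovation telescopes along the grid; each step is compared with its term of the sum.
  have htel : x t - Real.exp (-a * L) * x s = ∑ k ∈ Finset.range n,
      (Real.exp (-a * (t - p (k + 1))) * x (p (k + 1)) - Real.exp (-a * (t - p k)) * x (p k)) := by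
    rw [Finset.sum_range_sub (fun k => Real.exp (-a * (t - p k)) * x (p k))]
    have hp0 : p 0 = s := by simp [hp, gridPoint]
    have hpn : p n = t := by simp [hp, gridPoint, hn0.ne']
    rw [hp0, hpn]; simp [hL]
  rw [Real.dist_eq, htel, wienerSum, ← Finset.sum_sub_distrib]
  have hterm : ∀ k ∈ Finset.range n,
      |Real.exp (-a * (t - p (k + 1))) * (w (p (k + 1)) - w (p k)) -
        (Real.exp (-a * (t - p (k + 1))) * x (p (k + 1)) - Real.exp (-a * (t - p k)) * x (p k))|
      ≤ a * η * ε' + a ^ 2 * η ^ 2 * M := by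
    intro k hk
    have hk' : k + 1 ≤ n := Finset.mem_range.1 hk
    have hmem1 : p (k + 1) ∈ Set.Icc s t := gridPoint_mem_Icc hst hk'
    have hmem0 : p k ∈ Set.Icc s t := gridPoint_mem_Icc hst (by omega)
    have hexp : Real.exp (-a * (t - p k)) =
        Real.exp (-a * (t - p (k + 1))) * Real.exp (-(a * η)) := by
      rw [← Real.exp_add, hps]; ring_nf
    have hint : ∫ r in (p k)..(p (k + 1)), x r =
        (∫ r in (p k)..(p (k + 1)), (x r - x (p k))) + η * x (p k) := by
      rw [intervalIntegral.integral_sub (hx.intervalIntegrable _ _) (by simp)]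
      simp [hps]
    have hI : |∫ r in (p k)..(p (k + 1)), (x r - x (p k))| ≤ ε' * η := by
      have := intervalIntegral.norm_integral_le_of_norm_le_const (a := p k) (b := p (k + 1))
        (f := fun r => x r - x (p k)) (C := ε') (fun r hr => ?_)
      · rw [Real.norm_eq_abs] at this
        rwa [show p (k + 1) - p k = η by rw [hps]; ring, abs_of_nonneg hη0] at this
      · rw [Set.uIoc_of_le (by rw [hps]; linarith)] at hr
        have hr1 : r ∈ Set.Icc s t := ⟨hmem0.1.trans hr.1.le, hr.2.trans hmem1.2⟩
        have := hδx r hr1 (p k) hmem0 (by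
          rw [Real.dist_eq, abs_of_pos (by linarith [hr.1])]
          have := hr.2; rw [hps] at this; linarith)
        rw [Real.dist_eq] at this
        exact this.le
    -- The equation turns the difference of the two terms into a local error of size `o(η)`: the
    -- oscillation of `x` on the step, and the second-order error of `e^{-aη} ≈ 1 - aη`.
    have key : Real.exp (-a * (t - p (k + 1))) * (w (p (k + 1)) - w (p k)) -
        (Real.exp (-a * (t - p (k + 1))) * x (p (k + 1)) - Real.exp (-a * (t - p k)) * x (p k)) =
        Real.exp (-a * (t - p (k + 1))) * (a * (∫ r in (p k)..(p (k + 1)), (x r - x (p k))) +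
          (a * η - 1 + Real.exp (-(a * η))) * x (p k)) := by
      rw [hexp, hw _ hmem0 _ hmem1, hint]; ring
    rw [key, abs_mul, abs_of_pos (Real.exp_pos _)]
    have hc : Real.exp (-a * (t - p (k + 1))) ≤ 1 := by
      rw [Real.exp_le_one_iff]; nlinarith [hmem1.2]
    refine (mul_le_of_le_one_left (abs_nonneg _) hc).trans ((abs_add_le _ _).trans ?_)
    rw [abs_mul, abs_mul, abs_of_nonneg ha]
    have hb1 := exp_neg_sub_one_add_bound (mul_nonneg ha hη0)
    have hb2 : |x (p k)| ≤ M := hM _ hmem0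
    have := mul_le_mul hb1 hb2 (abs_nonneg _) (by positivity)
    have := mul_le_mul_of_nonneg_left hI ha
    nlinarith
  refine (Finset.abs_sum_le_sum_abs _ _).trans_lt ((Finset.sum_le_sum hterm).trans_lt ?_)
  rw [Finset.sum_const, Finset.card_range, nsmul_eq_mul]
  have hnη : (n : ℝ) * η = L := by rw [hη]; field_simp
  have e1 : (n : ℝ) * (a * η * ε' + a ^ 2 * η ^ 2 * M) = a * L * ε' + a ^ 2 * L * M * η := by
    rw [← hnη]; ring
  have e2 : a * L * ε' ≤ ε / 2 := by
    rw [hε', mul_div_assoc', div_le_iff₀ (by positivity)]; nlinarith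
  rw [e1]; linarith

/-- The variance `(1 - e^{-2 a h}) / (2 a)` of the innovation over a time step `h` of the
Ornstein-Uhlenbeck process with drift `-a x`. -/
noncomputable def ouVar (a h : ℝ) : ℝ := (1 - Real.exp (-2 * a * h)) / (2 * a)

/-- `∑ e^{-2 a (t - s_{k+1})} (s_{k+1} - s_k)` is itself a Riemann sum of the kind treated in
`tendsto_wienerSum`, for the solution `x_u = (1 - e^{-2 a (u - s)}) / (2 a)` of
`dx = -2 a x du + du`. -/
theorem tendsto_wienerSum_id {a s t : ℝ} (ha : 0 < a) (hst : s ≤ t) :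
    Tendsto (wienerSum (2 * a) s t id) atTop (𝓝 (ouVar a (t - s))) := by
  have hd : ∀ u, HasDerivAt (fun u => ouVar a (u - s)) (1 - 2 * a * ouVar a (u - s)) u := by
    intro u
    have := (((((hasDerivAt_id u).sub_const s).const_mul (-2 * a)).exp.const_sub 1).div_const
      (2 * a))
    refine (this.congr_deriv ?_)
    simp only [ouVar, id]
    field_simp
    ring
  have hc : Continuous fun u => ouVar a (u - s) :=
    continuous_iff_continuousAt.2 fun u => (hd u).continuousAt
  have := tendsto_wienerSum (a := 2 * a) (x := fun u => ouVar a (u - s)) (w := id)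
    (by positivity) hst hc (fun u _ v _ => by
      have h1 := intervalIntegral.integral_eq_sub_of_hasDerivAt (a := u) (b := v)
        (fun r _ => hd r) ((by fun_prop : Continuous _).intervalIntegrable _ _)
      rw [intervalIntegral.integral_sub (by simp)
        ((by fun_prop : Continuous _).intervalIntegrable _ _),
        intervalIntegral.integral_const_mul] at h1
      simp at h1 ⊢; linarith)
  simpa [ouVar] using this

/-! ### Gaussian laws of the Riemann sums and of their limits -/

section
variable {Ω : Type*} {mΩ : MeasurableSpace Ω} {P : Measure Ω} {B : ℝ≥0 → Ω → ℝ}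

lemma ProbabilityTheory.IsPreBrownianReal.memLp_two_sub (hB : IsPreBrownianReal B P)
    (s t : ℝ≥0) : MemLp (fun ω => B t ω - B s ω) 2 P :=
  hB.isGaussianProcess.hasGaussianLaw_fun_sub.memLp_two

lemma ProbabilityTheory.IsPreBrownianReal.covariance_sub_sub (hB : IsPreBrownianReal B P)
    (a b c d : ℝ≥0) :
    cov[fun ω => B b ω - B a ω, fun ω => B d ω - B c ω; P] =
      min b d - min b c - (min a d - min a c) := by
  have : IsProbabilityMeasure P := hB.isGaussianProcess.isProbabilityMeasure
  have h : ∀ t, MemLp (fun ω => B t ω) 2 P := fun t =>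
    (hB.isGaussianProcess.hasGaussianLaw_eval t).memLp_two
  rw [covariance_fun_sub_left (h _) (h _) (hB.memLp_two_sub _ _),
    covariance_fun_sub_right (h _) (h _) (h _), covariance_fun_sub_right (h _) (h _) (h _)]
  simp only [hB.covariance_fun_eval]

lemma ProbabilityTheory.IsPreBrownianReal.covariance_sub_sub_of_le (hB : IsPreBrownianReal B P)
    {a b c d : ℝ≥0} (hab : a ≤ b) (hbc : b ≤ c) (hcd : c ≤ d) :
    cov[fun ω => B b ω - B a ω, fun ω => B d ω - B c ω; P] = 0 := by
  rw [hB.covariance_sub_sub, min_eq_left (hbc.trans hcd), min_eq_left hbc,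
    min_eq_left (hab.trans (hbc.trans hcd)), min_eq_left (hab.trans hbc)]
  simp

lemma ProbabilityTheory.IsPreBrownianReal.covariance_sub_self (hB : IsPreBrownianReal B P)
    {a b : ℝ≥0} (hab : a ≤ b) :
    cov[fun ω => B b ω - B a ω, fun ω => B b ω - B a ω; P] = (b : ℝ) - a := by
  rw [hB.covariance_sub_sub, min_self, min_eq_right hab, min_eq_left hab, min_self]
  simp

lemma ProbabilityTheory.IsPreBrownianReal.integral_sub_eq_zero (hB : IsPreBrownianReal B P)
    (a b : ℝ≥0) : ∫ ω, (B b ω - B a ω) ∂P = 0 := by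
  rw [integral_sub (hB.integrable_eval b) (hB.integrable_eval a)]
  have h1 := hB.integral_eval a
  have h2 := hB.integral_eval b
  simp_all

variable {N : ℕ} {t : Fin (N + 1) → ℝ≥0}

/-- The Riemann sums of `wienerSum` over the successive intervals of `t` are independent centred
Gaussian variables, because they are combinations of increments over disjoint intervals. -/
theorem ProbabilityTheory.IsPreBrownianReal.map_wienerSum (hB : IsPreBrownianReal B P)
    (ht : Monotone t) (a : ℝ) (n : ℕ) :
    P.map (fun ω (i : Fin N) =>
        wienerSum a (t i.castSucc) (t i.succ) (fun u => B u.toNNReal ω) n) =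
      Measure.pi fun i : Fin N =>
        gaussianReal 0 (wienerSum (2 * a) (t i.castSucc) (t i.succ) id n).toNNReal := by
  classical
  have hP : IsProbabilityMeasure P := hB.isGaussianProcess.isProbabilityMeasure
  have hti : ∀ i : Fin N, (t i.castSucc : ℝ) ≤ t i.succ := fun i =>
    NNReal.coe_le_coe.2 (ht (Fin.castSucc_lt_succ (i := i)).le)
  set p : Fin N → ℕ → ℝ := fun i k => gridPoint (t i.castSucc) (t i.succ) n k with hp
  set c : Fin N → ℕ → ℝ := fun i k => Real.exp (-a * (t i.succ - p i (k + 1))) with hc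
  have hpmono : ∀ i, Monotone fun k => (p i k).toNNReal := fun i k l hkl =>
    Real.toNNReal_le_toNNReal (gridPoint_mono (hti i) n hkl)
  have hpmem : ∀ i k, k ≤ n → t i.castSucc ≤ (p i k).toNNReal ∧ (p i k).toNNReal ≤ t i.succ := by
    intro i k hk
    have := gridPoint_mem_Icc (hti i) hk
    exact ⟨by
        rw [Real.le_toNNReal_iff_coe_le (by exact (NNReal.coe_nonneg _).trans this.1)]
        exact this.1,
      by rw [Real.toNNReal_le_iff_le_coe]; exact this.2⟩
  set Y : Fin N → Fin n → Ω → ℝ := fun i k ω =>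
    c i k * (B (p i (k + 1)).toNNReal ω - B (p i k).toNNReal ω) with hY
  set S : Fin N → Ω → ℝ := fun i ω => ∑ k, Y i k ω with hS
  have hSeq : (fun ω (i : Fin N) =>
        wienerSum a (t i.castSucc) (t i.succ) (fun u => B u.toNNReal ω) n) =
      fun ω i => S i ω := by
    funext ω i
    simp only [wienerSum, hS, hY, Finset.sum_range, hc, hp]
  have hYL : ∀ i k, MemLp (Y i k) 2 P := fun i k => (hB.memLp_two_sub _ _).const_mul _
  have hcov : ∀ i j k l, cov[Y i k, Y j l; P] = c i k * (c j l *
      cov[fun ω => B (p i (k + 1)).toNNReal ω - B (p i k).toNNReal ω,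
        fun ω => B (p j (l + 1)).toNNReal ω - B (p j l).toNNReal ω; P]) := by
    intro i j k l
    simp only [hY]
    rw [covariance_const_mul_left, covariance_const_mul_right]
  have hlt : ∀ i j k l, (i < j ∨ (i = j ∧ k < l)) → cov[Y i k, Y j l; P] = 0 := by
    intro i j k l h
    rw [hcov, hB.covariance_sub_sub_of_le (hpmono i (Nat.le_succ _)) ?_ (hpmono j (Nat.le_succ _))]
    · simp
    · rcases h with h | ⟨rfl, h⟩
      · refine (hpmem i _ k.2).2.trans (le_trans (ht ?_) (hpmem j _ l.2.le).1)
        exact Fin.succ_le_castSucc_iff.2 h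
      · exact hpmono i h
  have hcovS : ∀ i j, cov[S i, S j; P] = ∑ k, ∑ l, cov[Y i k, Y j l; P] := fun i j =>
    covariance_fun_sum_fun_sum (hYL i) (hYL j)
  have hcov0 : ∀ i j, i ≠ j → cov[S i, S j; P] = 0 := by
    intro i j hij
    rw [hcovS]
    refine Finset.sum_eq_zero fun k _ => Finset.sum_eq_zero fun l _ => ?_
    rcases lt_or_gt_of_ne hij with h | h
    · exact hlt _ _ _ _ (Or.inl h)
    · rw [covariance_comm]; exact hlt _ _ _ _ (Or.inl h)
  have hvar : ∀ i, Var[S i; P] = wienerSum (2 * a) (t i.castSucc) (t i.succ) id n := by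
    intro i
    have hSL : MemLp (S i) 2 P := memLp_finsetSum _ fun k _ => hYL i k
    rw [← covariance_self hSL.aemeasurable, hcovS, wienerSum, Finset.sum_range]
    refine Finset.sum_congr rfl fun k _ => ?_
    rw [Finset.sum_eq_single k]
    · rw [hcov, hB.covariance_sub_self (hpmono i (Nat.le_succ _)), ← mul_assoc, ← Real.exp_add,
        Real.coe_toNNReal, Real.coe_toNNReal]
      · simp only [hp, id, Nat.succ_eq_add_one]; ring_nf
      · exact (NNReal.coe_nonneg _).trans (gridPoint_mem_Icc (hti i) k.2.le).1
      · exact (NNReal.coe_nonneg _).trans (gridPoint_mem_Icc (hti i) k.2).1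
    · intro l _ hl
      rcases lt_or_gt_of_ne hl with h | h
      · rw [covariance_comm]; exact hlt _ _ _ _ (Or.inr ⟨rfl, h⟩)
      · exact hlt _ _ _ _ (Or.inr ⟨rfl, h⟩)
    · simp
  have hmean : ∀ i, ∫ ω, S i ω ∂P = 0 := by
    intro i
    rw [integral_finsetSum _ fun k _ => (hYL i k).integrable one_le_two]
    refine Finset.sum_eq_zero fun k _ => ?_
    simp only [hY]
    rw [integral_const_mul, hB.integral_sub_eq_zero, mul_zero]
  -- Jointly Gaussian: a linear image of the values of `B` at the finitely many grid points.
  have hG : HasGaussianLaw (fun ω i => S i ω) P := by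
    set I : Finset ℝ≥0 := Finset.univ.image
      (fun x : Fin N × Fin (n + 1) => (p x.1 x.2).toNNReal) with hI
    have hmem : ∀ i (k : ℕ), k < n + 1 → (p i k).toNNReal ∈ I := fun i k hk =>
      Finset.mem_image.2 ⟨(i, ⟨k, hk⟩), Finset.mem_univ _, rfl⟩
    let L : (I → ℝ) →ₗ[ℝ] (Fin N → ℝ) :=
      { toFun := fun x i => ∑ k : Fin n, c i k * (x ⟨_, hmem i (k + 1) (by omega)⟩ -
          x ⟨_, hmem i k (by omega)⟩)
        map_add' := by
          intro x y; funext i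
          simp only [Pi.add_apply, ← Finset.sum_add_distrib]
          exact Finset.sum_congr rfl fun k _ => by ring
        map_smul' := by
          intro r x; funext i
          simp only [Pi.smul_apply, smul_eq_mul, RingHom.id_apply, Finset.mul_sum]
          exact Finset.sum_congr rfl fun k _ => by ring }
    exact (hB.isGaussianProcess.hasGaussianLaw I).map (LinearMap.toContinuousLinearMap L)
  rw [hSeq, (hG.iIndepFun_of_covariance_eq_zero hcov0).map_fun_eq_pi_map
    fun i => (hG.eval i).aemeasurable]
  congr 1; funext i
  rw [(hG.eval i).map_eq_gaussianReal, hvar, hmean]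

end

/-- A product of centred Gaussian laws is the image of the standard Gaussian law under a scaling
of the coordinates. -/
lemma pi_gaussianReal_eq_map {ι : Type*} [Fintype ι] (v : ι → ℝ) :
    (Measure.pi fun i => gaussianReal 0 (v i).toNNReal) =
      (Measure.pi fun _ : ι => gaussianReal 0 1).map fun z i => √(v i) * z i := by
  rw [Measure.pi_map_pi (f := fun i (z : ℝ) => √(v i) * z)
    (fun i => (measurable_const_mul _).aemeasurable)]
  congr 1; funext i
  rw [gaussianReal_map_const_mul]
  congr 1
  · simp
  · ext; simp [Real.sq_sqrt', Real.coe_toNNReal']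

/-- If arrays of independent centred Gaussian variables converge almost surely and their
variances converge, the limit is an array of independent centred Gaussian variables with the
limiting variances. -/
theorem map_eq_pi_gaussianReal_of_tendsto {Ω : Type*} {mΩ : MeasurableSpace Ω} {P : Measure Ω}
    [IsProbabilityMeasure P] {ι κ : Type*} [Fintype ι] [Fintype κ]
    {Y : ℕ → Ω → ι → κ → ℝ} {Z : Ω → ι → κ → ℝ} {v : ℕ → ι → κ → ℝ} {v' : ι → κ → ℝ}
    (hY : ∀ n, AEMeasurable (Y n) P) (hZ : AEMeasurable Z P)
    (hlaw : ∀ n, P.map (Y n) =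
      Measure.pi fun i => Measure.pi fun k => gaussianReal 0 (v n i k).toNNReal)
    (hv : ∀ i k, Tendsto (fun n => v n i k) atTop (𝓝 (v' i k)))
    (hYZ : ∀ᵐ ω ∂P, ∀ i k, Tendsto (fun n => Y n ω i k) atTop (𝓝 (Z ω i k))) :
    P.map Z = Measure.pi fun i => Measure.pi fun k => gaussianReal 0 (v' i k).toNNReal := by
  have key : ∀ v : ι → κ → ℝ,
      (Measure.pi fun i => Measure.pi fun k => gaussianReal 0 (v i k).toNNReal) =
      (Measure.pi fun _ : ι => Measure.pi fun _ : κ => gaussianReal 0 1).map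
        fun z i k => √(v i k) * z i k := by
    intro v
    rw [Measure.pi_map_pi (f := fun i (z : κ → ℝ) k => √(v i k) * z k)
      (fun i => (by fun_prop : Measurable _).aemeasurable)]
    simp_rw [← pi_gaussianReal_eq_map]
  have hs : ∀ v : ι → κ → ℝ, AEMeasurable (fun (z : ι → κ → ℝ) i k => √(v i k) * z i k)
      (Measure.pi fun _ : ι => Measure.pi fun _ : κ => gaussianReal 0 1) := fun v =>
    (by fun_prop : Measurable _).aemeasurable
  have : IsProbabilityMeasure (P.map Z) := Measure.isProbabilityMeasure_map hZ
  refine ext_of_forall_integral_eq_of_IsFiniteMeasure fun f => ?_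
  have h1 : Tendsto (fun n => ∫ ω, f (Y n ω) ∂P) atTop (𝓝 (∫ ω, f (Z ω) ∂P)) := by
    refine tendsto_integral_of_dominated_convergence (fun _ => ‖f‖) (fun n => ?_)
      (integrable_const _) (fun n => ae_of_all _ fun ω => f.norm_coe_le_norm _) ?_
    · exact (f.continuous.measurable.comp_aemeasurable (hY n)).aestronglyMeasurable
    · filter_upwards [hYZ] with ω hω
      exact (f.continuous.tendsto _).comp
        (tendsto_pi_nhds.2 fun i => tendsto_pi_nhds.2 fun k => hω i k)
  have h2 : Tendsto (fun n => ∫ z, f (fun i k => √(v n i k) * z i k)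
      ∂(Measure.pi fun _ : ι => Measure.pi fun _ : κ => gaussianReal 0 1)) atTop
      (𝓝 (∫ z, f (fun i k => √(v' i k) * z i k)
        ∂(Measure.pi fun _ : ι => Measure.pi fun _ : κ => gaussianReal 0 1))) := by
    refine tendsto_integral_of_dominated_convergence (fun _ => ‖f‖) (fun n => ?_)
      (integrable_const _) (fun n => ae_of_all _ fun ω => f.norm_coe_le_norm _) ?_
    · exact (f.continuous.measurable.comp (by fun_prop)).aestronglyMeasurable
    · refine ae_of_all _ fun z => (f.continuous.tendsto _).comp
        (tendsto_pi_nhds.2 fun i => tendsto_pi_nhds.2 fun k => ?_)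
      exact ((Real.continuous_sqrt.tendsto _).comp (hv i k)).mul_const _
  have h3 : ∀ n, ∫ ω, f (Y n ω) ∂P = ∫ z, f (fun i k => √(v n i k) * z i k)
      ∂(Measure.pi fun _ : ι => Measure.pi fun _ : κ => gaussianReal 0 1) := by
    intro n
    rw [← integral_map (hY n) f.continuous.measurable.aestronglyMeasurable, hlaw, key,
      integral_map (hs _) f.continuous.measurable.aestronglyMeasurable]
  rw [integral_map hZ f.continuous.measurable.aestronglyMeasurable, key,
    integral_map (hs _) f.continuous.measurable.aestronglyMeasurable]
  simp_rw [h3] at h1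
  exact tendsto_nhds_unique h1 h2

/-! ### Innovations of a linear system with diagonal drift -/

lemma toEuclideanLin_diagonal_apply {d : ℕ} (α : Fin d → ℝ) (x : EuclideanSpace ℝ (Fin d))
    (j : Fin d) : Matrix.toEuclideanLin (Matrix.diagonal α) x j = α j * x j := by
  simp [Matrix.toLpLin_apply, Matrix.mulVec_diagonal]

lemma measurable_wienerSum {α : Type*} [MeasurableSpace α] (a s t : ℝ) (n : ℕ) {f : ℝ → α → ℝ}
    (hf : ∀ u, Measurable (f u)) : Measurable fun ω => wienerSum a s t (fun u => f u ω) n :=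
  Finset.measurable_fun_sum _ fun _ _ => ((hf _).sub (hf _)).const_mul _

/-- The innovations of an uncontrolled linear system with diagonal drift matrix: coordinates and
time steps are all independent, and each innovation is a centred Gaussian variable. -/
theorem IsLinearSystem.map_innovation {Ω : Type*} {mΩ : MeasurableSpace Ω} {d p N : ℕ}
    {P : Measure Ω} [IsProbabilityMeasure P] {𝓕 : Filtration ℝ≥0 mΩ}
    {W : ℝ≥0 → Ω → EuclideanSpace ℝ (Fin d)} {U : ℝ≥0 → Ω → EuclideanSpace ℝ (Fin p)}
    {X : ℝ≥0 → Ω → EuclideanSpace ℝ (Fin d)} {α : Fin d → ℝ} (hα : ∀ j, 0 < α j)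
    (h : IsLinearSystem (Matrix.diagonal fun j => -α j) 0 P 𝓕 W U X)
    {t : Fin (N + 1) → ℝ≥0} (ht : Monotone t) :
    P.map (fun ω j (i : Fin N) => X (t i.succ) ω j -
        Real.exp (-α j * (t i.succ - t i.castSucc)) * X (t i.castSucc) ω j) =
      Measure.pi fun j => Measure.pi fun i : Fin N =>
        gaussianReal 0 (ouVar (α j) (t i.succ - t i.castSucc)).toNNReal := by
  have hti : ∀ i : Fin N, (t i.castSucc : ℝ) ≤ t i.succ := fun i =>
    NNReal.coe_le_coe.2 (ht (Fin.castSucc_lt_succ (i := i)).le)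
  have hWm : ∀ s j, Measurable fun ω => W s ω j := fun s j => by
    have := (h.noise.adapted s).mono (𝓕.le s) le_rfl
    fun_prop
  have hXm : ∀ s j, Measurable fun ω => X s ω j := fun s j => by
    have := (h.state_adapted s).mono (𝓕.le s) le_rfl
    fun_prop
  have hSm : ∀ n j, Measurable fun (w : ℝ≥0 → ℝ) (i : Fin N) =>
      wienerSum (α j) (t i.castSucc) (t i.succ) (fun u => w u.toNNReal) n := fun n j =>
    measurable_pi_lambda _ fun i => measurable_wienerSum _ _ _ _ fun u => measurable_pi_apply _
  have hWp : ∀ j, Measurable fun ω (s : ℝ≥0) => W s ω j := fun j =>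
    measurable_pi_lambda _ fun s => hWm s j
  have hYm : ∀ n, Measurable fun ω j (i : Fin N) =>
      wienerSum (α j) (t i.castSucc) (t i.succ) (fun u => W u.toNNReal ω j) n := fun n =>
    measurable_pi_lambda _ fun j => measurable_pi_lambda _ fun i =>
      measurable_wienerSum _ _ _ _ fun u => hWm u.toNNReal j
  have hZm : Measurable fun ω j (i : Fin N) => X (t i.succ) ω j -
      Real.exp (-α j * (t i.succ - t i.castSucc)) * X (t i.castSucc) ω j :=
    measurable_pi_lambda _ fun j => measurable_pi_lambda _ fun i =>
      (hXm _ j).sub ((hXm _ j).const_mul _)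
  refine map_eq_pi_gaussianReal_of_tendsto
    (Y := fun n ω j (i : Fin N) =>
      wienerSum (α j) (t i.castSucc) (t i.succ) (fun u => W u.toNNReal ω j) n)
    (v := fun n j (i : Fin N) => wienerSum (2 * α j) (t i.castSucc) (t i.succ) id n)
    (fun n => (hYm n).aemeasurable) hZm.aemeasurable (fun n => ?_)
    (fun j i => tendsto_wienerSum_id (hα j) (hti i)) ?_
  · have hind := h.noise.indep_coord.comp (fun j (w : ℝ≥0 → ℝ) (i : Fin N) =>
      wienerSum (α j) (t i.castSucc) (t i.succ) (fun u => w u.toNNReal) n) (hSm n)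
    have := hind.map_fun_eq_pi_map fun j => ((hSm n j).comp (hWp j)).aemeasurable
    refine this.trans ?_
    congr 1; funext j
    exact (h.noise.coord j).toIsPreBrownianReal.map_wienerSum ht (α j) n
  · filter_upwards [h.state_continuous, h.equation] with ω hc he j i
    have hc' : Continuous fun u : ℝ => X u.toNNReal ω := hc.comp continuous_real_toNNReal
    have hcj : Continuous fun u : ℝ => X u.toNNReal ω j := by fun_prop
    have heq : ∀ u : ℝ, 0 ≤ u →
        X u.toNNReal ω j = -α j * (∫ r in (0 : ℝ)..u, X r.toNNReal ω j) + W u.toNNReal ω j := by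
      intro u hu
      conv_lhs => rw [he u.toNNReal]
      rw [PiLp.add_apply, Real.coe_toNNReal _ hu]
      congr 1
      have hci : IntervalIntegrable (fun s : ℝ =>
          Matrix.toEuclideanLin (Matrix.diagonal fun j => -α j) (X s.toNNReal ω) +
          Matrix.toEuclideanLin (0 : Matrix (Fin d) (Fin p) ℝ) (U s.toNNReal ω)) volume 0 u := by
        simp only [map_zero, LinearMap.zero_apply, add_zero]
        exact ((LinearMap.continuous_of_finiteDimensional _).comp hc').intervalIntegrable _ _
      have := ContinuousLinearMap.intervalIntegral_comp_comm
        (EuclideanSpace.proj j : EuclideanSpace ℝ (Fin d) →L[ℝ] ℝ) hci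
      simp only [PiLp.proj_apply] at this
      rw [← this, ← intervalIntegral.integral_const_mul]
      congr 1; funext r
      simp only [map_zero, LinearMap.zero_apply, add_zero]
      exact toEuclideanLin_diagonal_apply _ _ _
    have := tendsto_wienerSum (hα j).le (hti i) hcj (w := fun u => W u.toNNReal ω j)
      (fun u hu v hv => by
        have h1 := heq u ((NNReal.coe_nonneg _).trans hu.1)
        have h2 := heq v ((NNReal.coe_nonneg _).trans hv.1)
        rw [← intervalIntegral.integral_interval_sub_left (hcj.intervalIntegrable 0 v)
          (hcj.intervalIntegrable 0 u)]
        linarith)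
    simpa only [Real.toNNReal_coe] using this

/-! ### The autoregressive chain and its density -/

/-- Densities of the factors of a finite product measure multiply. -/
lemma pi_withDensity_ofReal {ι : Type*} [Fintype ι] {E : ι → Type*}
    [∀ i, MeasurableSpace (E i)] (μ : ∀ i, Measure (E i)) [∀ i, SigmaFinite (μ i)]
    {f : ∀ i, E i → ℝ} (hf0 : ∀ i x, 0 ≤ f i x) (hf : ∀ i, Integrable (f i) (μ i)) :
    Measure.pi (fun i => (μ i).withDensity fun x => ENNReal.ofReal (f i x)) =
      (Measure.pi μ).withDensity fun x => ENNReal.ofReal (∏ i, f i (x i)) := by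
  have : ∀ i, IsFiniteMeasure ((μ i).withDensity fun x => ENNReal.ofReal (f i x)) := fun i =>
    isFiniteMeasure_withDensity_ofReal (hf i).2
  refine Measure.pi_eq fun s hs => ?_
  rw [withDensity_apply _ (MeasurableSet.univ_pi hs), Measure.restrict_pi_pi,
    ← ofReal_integral_eq_lintegral_ofReal, integral_fintype_prod_eq_prod,
    ENNReal.ofReal_prod_of_nonneg]
  · refine Finset.prod_congr rfl fun i _ => ?_
    rw [withDensity_apply _ (hs i), ofReal_integral_eq_lintegral_ofReal (hf i).restrict
      (ae_of_all _ (hf0 i))]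
  · exact fun i _ => integral_nonneg (hf0 i)
  · exact Integrable.fintype_prod_dep fun i => (hf i).restrict
  · exact ae_of_all _ fun x => Finset.prod_nonneg fun i _ => hf0 i _

section Chain
variable {N : ℕ} (ρ : Fin N → ℝ)

/-- The solution `z_0 = 0`, `z_{i+1} = ρ_i z_i + ξ_i` of the autoregressive recursion. -/
noncomputable def arPath (ξ : Fin N → ℝ) (k : Fin (N + 1)) : ℝ :=
  Fin.induction (motive := fun _ => ℝ) 0 (fun i z => ρ i * z + ξ i) k

/-- The innovations `x_{i+1} - ρ_i x_i` of a path `x_1, …, x_N` with `x_0 = 0`; the path is indexed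
by `Fin N`, and `Fin.cons 0 x` restores its starting point. -/
noncomputable def arInnovation (x : Fin N → ℝ) (i : Fin N) : ℝ :=
  x i - ρ i * (Fin.cons 0 x : Fin (N + 1) → ℝ) i.castSucc

@[simp] lemma arPath_zero (ξ : Fin N → ℝ) : arPath ρ ξ 0 = 0 := rfl

@[simp] lemma arPath_succ (ξ : Fin N → ℝ) (i : Fin N) :
    arPath ρ ξ i.succ = ρ i * arPath ρ ξ i.castSucc + ξ i := rfl

lemma cons_arPath (ξ : Fin N → ℝ) :
    (Fin.cons 0 (fun i : Fin N => arPath ρ ξ i.succ) : Fin (N + 1) → ℝ) = arPath ρ ξ := by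
  funext k
  refine Fin.cases rfl (fun i => ?_) k
  rw [Fin.cons_succ]

lemma arPath_arInnovation (x : Fin N → ℝ) : arPath ρ (arInnovation ρ x) = Fin.cons 0 x := by
  funext k
  induction k using Fin.induction with
  | zero => rfl
  | succ i ih => rw [arPath_succ, ih, arInnovation, Fin.cons_succ]; ring

lemma measurable_arPath (k : Fin (N + 1)) : Measurable fun ξ => arPath ρ ξ k := by
  induction k using Fin.induction with
  | zero => exact measurable_const
  | succ i ih => simp only [arPath_succ]; fun_prop

lemma measurable_arInnovation : Measurable (arInnovation ρ) := by
  refine measurable_pi_lambda _ fun i => ?_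
  unfold arInnovation
  have : Measurable fun x : Fin N → ℝ => (Fin.cons 0 x : Fin (N + 1) → ℝ) i.castSucc := by
    generalize i.castSucc = k
    refine Fin.cases ?_ (fun j => ?_) k
    · simp
    · simpa using measurable_pi_apply j
  fun_prop

/-- Passing from a path to its innovations is a measurable bijection. -/
noncomputable def arInnovationEquiv : (Fin N → ℝ) ≃ᵐ (Fin N → ℝ) where
  toFun := arInnovation ρ
  invFun ξ i := arPath ρ ξ i.succ
  left_inv x := by funext i; simp only [arPath_arInnovation, Fin.cons_succ]
  right_inv ξ := by
    funext i
    rw [arInnovation, cons_arPath]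
    simp only [arPath_succ]; ring
  measurable_toFun := measurable_arInnovation ρ
  measurable_invFun := measurable_pi_lambda _ fun i => measurable_arPath ρ i.succ

/-- The innovation map is linear with a unit lower triangular matrix, so it preserves volume. -/
lemma measurePreserving_arInnovationEquiv : MeasurePreserving (arInnovationEquiv ρ) := by
  let M : Matrix (Fin N) (Fin N) ℝ := Matrix.of fun i j =>
    (if i = j then 1 else 0) - (if j.succ = i.castSucc then ρ i else 0)
  have hM : M.det = 1 := by
    rw [Matrix.det_of_isLowerTriangular]
    · refine Finset.prod_eq_one fun i _ => ?_
      simp [M, Fin.ext_iff]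
    · intro i j hij
      have hij' : i < j := hij
      have h1 : i ≠ j := hij'.ne
      have h2 : j.succ ≠ i.castSucc := by
        simp only [ne_eq, Fin.ext_iff, Fin.val_succ, Fin.val_castSucc]; omega
      simp [M, h1, h2]
  have hlin : ⇑(arInnovationEquiv ρ) = Matrix.toLin' M := by
    funext x i
    have hk : ∀ k : Fin (N + 1), (Fin.cons 0 x : Fin (N + 1) → ℝ) k =
        ∑ j, if j.succ = k then x j else 0 := by
      intro k
      refine Fin.cases ?_ (fun l => ?_) k
      · simp [Fin.succ_ne_zero]
      · simp
    change x i - ρ i * _ = _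
    rw [hk, Matrix.toLin'_apply, Matrix.mulVec, dotProduct]
    simp only [M, Matrix.of_apply, sub_mul, Finset.sum_sub_distrib, ite_mul, one_mul, zero_mul,
      Finset.sum_ite_eq, Finset.mem_univ, if_true, Finset.mul_sum, mul_ite, mul_zero]
  refine ⟨(arInnovationEquiv ρ).measurable, ?_⟩
  rw [hlin, Real.map_matrix_volume_pi_eq_smul_volume_pi (by rw [hM]; norm_num), hM]
  simp

end Chain

section Law
variable {N : ℕ}

lemma ouVar_pos {a h : ℝ} (ha : 0 < a) (hh : 0 < h) : 0 < ouVar a h := by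
  refine div_pos ?_ (by positivity)
  rw [sub_pos, Real.exp_lt_one_iff]
  have := mul_pos ha hh
  linarith

/-- The joint law of independent innovations of the Ornstein-Uhlenbeck process with drift `-a x`
over successive time steps `h_1, …, h_N`. -/
noncomputable def ouInnovationLaw (a : ℝ) (h : Fin N → ℝ) : Measure (Fin N → ℝ) :=
  Measure.pi fun i => gaussianReal 0 (ouVar a (h i)).toNNReal

instance (a : ℝ) (h : Fin N → ℝ) : IsProbabilityMeasure (ouInnovationLaw a h) := by
  unfold ouInnovationLaw; infer_instance

/-- The decay factors `e^{-a h_i}` of the Ornstein-Uhlenbeck process over the time steps `h_i`. -/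
noncomputable def ouDecay (a : ℝ) (h : Fin N → ℝ) (i : Fin N) : ℝ := Real.exp (-a * h i)

/-- The law of the Ornstein-Uhlenbeck process with drift `-a x`, started at `0`, at the ends of
successive time steps `h_1, …, h_N`. -/
noncomputable def ouLaw (a : ℝ) (h : Fin N → ℝ) : Measure (Fin N → ℝ) :=
  (ouInnovationLaw a h).map (arInnovationEquiv (ouDecay a h)).symm

instance (a : ℝ) (h : Fin N → ℝ) : IsProbabilityMeasure (ouLaw a h) :=
  Measure.isProbabilityMeasure_map (arInnovationEquiv _).symm.measurable.aemeasurable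

/-- The Lebesgue density of `ouLaw`. -/
noncomputable def ouDensity (a : ℝ) (h : Fin N → ℝ) (x : Fin N → ℝ) : ℝ :=
  ∏ i, gaussianPDFReal 0 (ouVar a (h i)).toNNReal (arInnovation (ouDecay a h) x i)

lemma measurable_ouDensity (a : ℝ) (h : Fin N → ℝ) : Measurable (ouDensity a h) := by
  unfold ouDensity
  have := measurable_arInnovation (ouDecay a h)
  have : ∀ i, Measurable fun x => gaussianPDFReal 0 (ouVar a (h i)).toNNReal
      (arInnovation (ouDecay a h) x i) := fun i =>
    (measurable_gaussianPDFReal _ _).comp ((measurable_pi_apply i).comp this)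
  fun_prop

lemma ouDensity_pos {a : ℝ} {h : Fin N → ℝ} (ha : 0 < a) (hh : ∀ i, 0 < h i) (x : Fin N → ℝ) :
    0 < ouDensity a h x :=
  Finset.prod_pos fun i _ => gaussianPDFReal_pos _ _ _
    (Real.toNNReal_pos.2 (ouVar_pos ha (hh i))).ne'

lemma ouLaw_eq_withDensity {a : ℝ} {h : Fin N → ℝ} (ha : 0 < a) (hh : ∀ i, 0 < h i) :
    ouLaw a h = volume.withDensity fun x => ENNReal.ofReal (ouDensity a h x) := by
  have h1 : ouInnovationLaw a h = volume.withDensity fun ξ =>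
      ENNReal.ofReal (∏ i, gaussianPDFReal 0 (ouVar a (h i)).toNNReal (ξ i)) := by
    rw [volume_pi, ← pi_withDensity_ofReal (fun _ => volume)
      (f := fun i => gaussianPDFReal 0 (ouVar a (h i)).toNNReal)
      (fun i x => gaussianPDFReal_nonneg _ _ x) (fun i => integrable_gaussianPDFReal _ _),
    ouInnovationLaw]
    congr 1; funext i
    rw [gaussianReal_of_var_ne_zero _ (Real.toNNReal_pos.2 (ouVar_pos ha (hh i))).ne']
    rfl
  have hp := (measurePreserving_arInnovationEquiv (ouDecay a h)).symm
  ext s hs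
  rw [ouLaw, h1, Measure.map_apply (MeasurableEquiv.measurable _) hs,
    withDensity_apply _ ((MeasurableEquiv.measurable _) hs), withDensity_apply _ hs,
    ← hp.setLIntegral_comp_preimage hs (measurable_ouDensity a h).ennreal_ofReal]
  refine lintegral_congr fun ξ => ?_
  have : arInnovation (ouDecay a h) ((arInnovationEquiv (ouDecay a h)).symm ξ) = ξ :=
    (arInnovationEquiv (ouDecay a h)).apply_symm_apply ξ
  simp only [ouDensity, this]

/-- The likelihood ratio of two Ornstein-Uhlenbeck processes observed at finitely many times. -/
noncomputable def ouRatio (a b : ℝ) (h : Fin N → ℝ) (x : Fin N → ℝ) : ℝ :=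
  ouDensity b h x / ouDensity a h x

lemma ouRatio_pos {a b : ℝ} {h : Fin N → ℝ} (ha : 0 < a) (hb : 0 < b) (hh : ∀ i, 0 < h i)
    (x : Fin N → ℝ) : 0 < ouRatio a b h x :=
  div_pos (ouDensity_pos hb hh x) (ouDensity_pos ha hh x)

lemma measurable_ouRatio (a b : ℝ) (h : Fin N → ℝ) : Measurable (ouRatio a b h) :=
  (measurable_ouDensity b h).div (measurable_ouDensity a h)

lemma ouLaw_eq_withDensity_ouRatio {a b : ℝ} {h : Fin N → ℝ} (ha : 0 < a) (hb : 0 < b)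
    (hh : ∀ i, 0 < h i) :
    ouLaw b h = (ouLaw a h).withDensity fun x => ENNReal.ofReal (ouRatio a b h x) := by
  rw [ouLaw_eq_withDensity ha hh, ouLaw_eq_withDensity hb hh,
    ← withDensity_mul _ (measurable_ouDensity a h).ennreal_ofReal
      (measurable_ouRatio a b h).ennreal_ofReal]
  congr 1; funext x
  rw [Pi.mul_apply, ← ENNReal.ofReal_mul (ouDensity_pos ha hh x).le, ouRatio,
    mul_div_cancel₀ _ (ouDensity_pos ha hh x).ne']

lemma integrable_ouRatio {a b : ℝ} {h : Fin N → ℝ} (ha : 0 < a) (hb : 0 < b)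
    (hh : ∀ i, 0 < h i) : Integrable (ouRatio a b h) (ouLaw a h) := by
  refine ⟨(measurable_ouRatio a b h).aestronglyMeasurable, ?_⟩
  rw [hasFiniteIntegral_iff_ofReal (ae_of_all _ fun x => (ouRatio_pos ha hb hh x).le)]
  have := measure_univ (μ := ouLaw b h)
  rw [ouLaw_eq_withDensity_ouRatio ha hb hh, withDensity_apply _ .univ, Measure.restrict_univ]
    at this
  rw [this]; exact ENNReal.one_lt_top

lemma integral_ouRatio {a b : ℝ} {h : Fin N → ℝ} (ha : 0 < a) (hb : 0 < b)
    (hh : ∀ i, 0 < h i) : ∫ x, ouRatio a b h x ∂(ouLaw a h) = 1 := by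
  rw [integral_eq_lintegral_of_nonneg_ae (ae_of_all _ fun x => (ouRatio_pos ha hb hh x).le)
    (measurable_ouRatio a b h).aestronglyMeasurable]
  have := measure_univ (μ := ouLaw b h)
  rw [ouLaw_eq_withDensity_ouRatio ha hb hh, withDensity_apply _ .univ, Measure.restrict_univ]
    at this
  rw [this]; rfl

end Law

/-! ### The expected log-likelihood ratio -/

section Moments
variable {N : ℕ} {a : ℝ} {h : Fin N → ℝ}

lemma memLp_two_innovation (a : ℝ) (h : Fin N → ℝ) (i : Fin N) :
    MemLp (fun ξ : Fin N → ℝ => ξ i) 2 (ouInnovationLaw a h) :=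
  (memLp_id_gaussianReal' 2 (by simp)).comp_measurePreserving
    (measurePreserving_eval (fun i => gaussianReal 0 (ouVar a (h i)).toNNReal) i)

lemma memLp_two_arPath (a : ℝ) (h ρ : Fin N → ℝ) (k : Fin (N + 1)) :
    MemLp (fun ξ => arPath ρ ξ k) 2 (ouInnovationLaw a h) := by
  induction k using Fin.induction with
  | zero => exact MemLp.zero
  | succ i ih => exact (ih.const_mul (ρ i)).add (memLp_two_innovation a h i)

lemma integral_innovation_sq (ha : 0 < a) (hh : ∀ i, 0 < h i) (i : Fin N) :
    ∫ ξ, ξ i ^ 2 ∂(ouInnovationLaw a h) = ouVar a (h i) := by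
  have h1 := integral_comp_eval (μ := fun i => gaussianReal 0 (ouVar a (h i)).toNNReal)
    (i := i) (f := fun x : ℝ => x ^ 2) (by fun_prop)
  have h2 := variance_fun_id_gaussianReal (μ := 0) (v := (ouVar a (h i)).toNNReal)
  rw [variance_of_integral_eq_zero (by fun_prop) (by simp)] at h2
  rw [ouInnovationLaw, h1, h2, Real.coe_toNNReal _ (ouVar_pos ha (hh i)).le]

lemma integral_innovation_mul_innovation {i j : Fin N} (hij : i ≠ j) :
    ∫ ξ, ξ i * ξ j ∂(ouInnovationLaw a h) = 0 := by
  have hind : iIndepFun (fun (i : Fin N) (ξ : Fin N → ℝ) => ξ i) (ouInnovationLaw a h) :=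
    iIndepFun_pi (X := fun _ x => x) fun i => aemeasurable_id
  rw [(hind.indepFun hij).integral_fun_mul_eq_mul_integral
    (memLp_two_innovation a h i).aestronglyMeasurable
    (memLp_two_innovation a h j).aestronglyMeasurable]
  have h1 := integral_comp_eval (μ := fun i => gaussianReal 0 (ouVar a (h i)).toNNReal)
    (i := i) (f := fun x : ℝ => x) (by fun_prop)
  rw [ouInnovationLaw, h1]
  simp

/-- The path up to time `k` is uncorrelated with every later innovation. -/
lemma integral_arPath_mul_innovation (ρ : Fin N → ℝ) (k : Fin (N + 1)) (i : Fin N)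
    (hki : k ≤ i.castSucc) : ∫ ξ, arPath ρ ξ k * ξ i ∂(ouInnovationLaw a h) = 0 := by
  induction k using Fin.induction with
  | zero => simp
  | succ j ih =>
    have hji : j ≠ i := by
      rintro rfl
      exact absurd hki (not_le.2 Fin.castSucc_lt_succ)
    simp only [arPath_succ, add_mul, mul_assoc]
    rw [integral_add, integral_const_mul, ih (Fin.castSucc_lt_succ.le.trans hki),
      integral_innovation_mul_innovation hji]
    · simp
    · exact ((memLp_two_arPath a h ρ _).integrable_mul (memLp_two_innovation a h i)).const_mul _
    · exact (memLp_two_innovation a h j).integrable_mul (memLp_two_innovation a h i)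

lemma integral_linear_sq (ha : 0 < a) (hh : ∀ i, 0 < h i) (ρ : Fin N → ℝ) (i : Fin N) (c : ℝ) :
    ∫ ξ, (ξ i + c * arPath ρ ξ i.castSucc) ^ 2 ∂(ouInnovationLaw a h) =
      ouVar a (h i) + c ^ 2 * ∫ ξ, arPath ρ ξ i.castSucc ^ 2 ∂(ouInnovationLaw a h) := by
  have e : ∀ ξ : Fin N → ℝ, (ξ i + c * arPath ρ ξ i.castSucc) ^ 2 =
      ξ i ^ 2 + (2 * c * (arPath ρ ξ i.castSucc * ξ i) + c ^ 2 * arPath ρ ξ i.castSucc ^ 2) :=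
    fun ξ => by ring
  have i1 := (memLp_two_innovation a h i).integrable_sq
  have i2 : Integrable (fun ξ => 2 * c * (arPath ρ ξ i.castSucc * ξ i)) (ouInnovationLaw a h) :=
    ((memLp_two_arPath a h ρ i.castSucc).integrable_mul
      (memLp_two_innovation a h i)).const_mul (2 * c)
  have i3 := (memLp_two_arPath a h ρ i.castSucc).integrable_sq.const_mul (c ^ 2)
  simp_rw [e]
  rw [integral_add i1 (by exact i2.add i3), integral_add i2 i3,
    integral_const_mul, integral_const_mul,
    integral_innovation_sq ha hh, integral_arPath_mul_innovation ρ _ i le_rfl]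
  ring

/-- The second moment of the Ornstein-Uhlenbeck process never exceeds its stationary value. -/
lemma integral_arPath_sq_le (ha : 0 < a) (hh : ∀ i, 0 < h i) (k : Fin (N + 1)) :
    ∫ ξ, arPath (ouDecay a h) ξ k ^ 2 ∂(ouInnovationLaw a h) ≤ 1 / (2 * a) := by
  induction k using Fin.induction with
  | zero => simp; positivity
  | succ i ih =>
    have := integral_linear_sq ha hh (ouDecay a h) i (ouDecay a h i)
    simp only [arPath_succ]
    simp_rw [add_comm (ouDecay a h i * _)]
    rw [this]
    have h1 : ouDecay a h i ^ 2 = 1 - 2 * a * ouVar a (h i) := by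
      rw [ouVar, mul_div_cancel₀ _ (by positivity), ouDecay, ← Real.exp_nat_mul]
      push_cast; ring_nf
    have h2 := mul_le_mul_of_nonneg_left ih (sq_nonneg (ouDecay a h i))
    have h3 : ouVar a (h i) + ouDecay a h i ^ 2 * (1 / (2 * a)) = 1 / (2 * a) := by
      rw [h1]; field_simp; ring
    linarith

end Moments

lemma log_gaussianPDFReal_zero {v : ℝ} (hv : 0 < v) (x : ℝ) :
    Real.log (gaussianPDFReal 0 v.toNNReal x) =
      -(1 / 2) * Real.log (2 * Real.pi * v) - x ^ 2 / (2 * v) := by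
  have h2 : 0 < 2 * Real.pi * v := by positivity
  rw [gaussianPDFReal, Real.coe_toNNReal _ hv.le, Real.log_mul (by positivity) (by positivity),
    Real.log_exp, Real.log_inv, Real.log_sqrt h2.le]
  simp; ring

/-- The expected log-likelihood ratio contributed by one time step `h`: the divergence between the
two transition laws is of order `δ² h`, because the relative change of the variance is at most
both `δ` and `2 δ h`, and that of the conditional mean is at most `δ h`. -/
lemma step_log_ratio_ge {δ y m : ℝ} (hδ : 0 ≤ δ) (hδ1 : δ ≤ 1 / 5) (hy : 0 < y)
    (hm : m ≤ 1 / 2) :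
    -(3 / 2) * δ ^ 2 * y ≤ 1 / 2 * (Real.log (ouVar 1 y) - Real.log (ouVar (1 + δ) y)) -
      (ouVar 1 y + (Real.exp (-y) - Real.exp (-(1 + δ) * y)) ^ 2 * m) / (2 * ouVar (1 + δ) y)
      + 1 / 2 := by
  have hva := ouVar_pos one_pos hy
  have hvb := ouVar_pos (a := 1 + δ) (by linarith) hy
  set q := Real.exp (-2 * y) with hq
  set g := Real.exp (-2 * δ * y) with hg
  have ea : ouVar 1 y = (1 - q) / 2 := by simp [ouVar, hq]
  have eb : ouVar (1 + δ) y = (1 - q * g) / (2 * (1 + δ)) := by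
    rw [ouVar, hq, hg, ← Real.exp_add]; ring_nf
  set va := ouVar 1 y
  set vb := ouVar (1 + δ) y
  have hq0 : 0 < q := Real.exp_pos _
  have hg0 : 0 < g := Real.exp_pos _
  have hδy : 0 ≤ δ * y := by positivity
  have hg1 : g ≤ 1 := by rw [hg, Real.exp_le_one_iff]; nlinarith
  have hq1 : 1 - 2 * y ≤ q := by have := Real.add_one_le_exp (-2 * y); linarith
  -- `1 + 2 y ≤ e^{2 y}`, multiplied by `q = e^{-2 y}`
  have hq2 : q * (1 + 2 * y) ≤ 1 := by
    have h1 := Real.add_one_le_exp (2 * y)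
    have h2 : q * Real.exp (2 * y) = 1 := by rw [hq, ← Real.exp_add]; simp
    nlinarith
  have hgl : 1 - 2 * (δ * y) ≤ g := by have := Real.add_one_le_exp (-2 * δ * y); linarith
  have hgu : g * (1 + 2 * (δ * y)) ≤ 1 := by
    have h1 := Real.add_one_le_exp (2 * (δ * y))
    have h2 : g * Real.exp (2 * (δ * y)) = 1 := by
      rw [hg, ← Real.exp_add, show -2 * δ * y + 2 * (δ * y) = 0 by ring, Real.exp_zero]
    nlinarith
  have eb' : 2 * (1 + δ) * vb = 1 - q * g := by rw [eb]; field_simp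
  have ea' : 2 * va = 1 - q := by rw [ea]; ring
  have hab : va ≤ (1 + δ) * vb := by nlinarith
  have hba : vb ≤ va := by
    have : 1 - q * g ≤ (1 + δ) * (1 - q) := by nlinarith
    nlinarith
  have hba2 : va * (1 - 2 * (δ * y)) ≤ vb := by
    rcases le_or_gt 1 (2 * (δ * y)) with hc | hc
    · nlinarith
    · have h1 : q * g * (1 + 2 * (δ * y)) ≤ q := by nlinarith
      have h2 : (1 + δ) * (1 - q) ≤ 1 + 2 * (δ * y) - q := by nlinarith
      have h3 : (1 + δ) * (1 - q) * (1 - (2 * (δ * y)) ^ 2) ≤ (1 + δ) * (1 - q) :=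
        mul_le_of_le_one_right (mul_nonneg (by linarith) (by linarith))
          (by linarith [sq_nonneg (2 * (δ * y))])
      have h4 : (1 + δ) * (1 - q) * (1 - 2 * (δ * y)) * (1 + 2 * (δ * y)) ≤
          (1 - q * g) * (1 + 2 * (δ * y)) := by nlinarith
      have h5 := le_of_mul_le_mul_right h4 (by linarith)
      rw [← ea', ← eb'] at h5
      exact le_of_mul_le_mul_left (by linarith) (by linarith : 0 < 2 * (1 + δ))
  have hmean : (Real.exp (-y) - Real.exp (-(1 + δ) * y)) ^ 2 ≤ δ ^ 2 * y * va := by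
    have e1 : Real.exp (-(1 + δ) * y) = Real.exp (-y) * Real.exp (-(δ * y)) := by
      rw [← Real.exp_add]; ring_nf
    have e2 : Real.exp (-y) ^ 2 = q := by
      rw [hq, ← Real.exp_nat_mul]; push_cast; ring_nf
    have e3 : 1 - Real.exp (-(δ * y)) ≤ δ * y := by
      have := Real.add_one_le_exp (-(δ * y)); linarith
    have e4 : 0 ≤ 1 - Real.exp (-(δ * y)) := by
      have : Real.exp (-(δ * y)) ≤ 1 := by rw [Real.exp_le_one_iff]; linarith
      linarith
    have e5 : (1 - Real.exp (-(δ * y))) ^ 2 ≤ (δ * y) ^ 2 := pow_le_pow_left₀ e4 e3 2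
    have e6 : q * y ≤ va := by nlinarith
    calc (Real.exp (-y) - Real.exp (-(1 + δ) * y)) ^ 2
        = q * (1 - Real.exp (-(δ * y))) ^ 2 := by rw [e1, ← e2]; ring
      _ ≤ q * (δ * y) ^ 2 := by gcongr
      _ = δ ^ 2 * y * (q * y) := by ring
      _ ≤ δ ^ 2 * y * va := by gcongr
  -- With `r = va / vb` this gives `r - 1 - log r ≤ (r - 1) (1 - 1 / r)`, a product of two small
  -- factors.
  have hlog : 1 - vb / va ≤ Real.log va - Real.log vb := by
    have := Real.log_le_sub_one_of_pos (div_pos hvb hva)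
    rw [Real.log_div hvb.ne' hva.ne'] at this
    linarith
  have hb1 : vb / va ≤ 1 := (div_le_one hva).2 hba
  have hb2 : 1 - 2 * (δ * y) ≤ vb / va := by rw [le_div_iff₀ hva]; linarith
  have hb3 : va / vb ≤ 1 + δ := by rw [div_le_iff₀ hvb]; exact hab
  have hb4 : 1 ≤ va / vb := (one_le_div hvb).2 hba
  have hsplit : (va + (Real.exp (-y) - Real.exp (-(1 + δ) * y)) ^ 2 * m) / (2 * vb) ≤
      va / vb / 2 + δ ^ 2 * y * (va / vb) / 4 := by
    have : (Real.exp (-y) - Real.exp (-(1 + δ) * y)) ^ 2 * m ≤ δ ^ 2 * y * va * (1 / 2) := by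
      have := mul_le_mul_of_nonneg_left hm
        (sq_nonneg (Real.exp (-y) - Real.exp (-(1 + δ) * y)))
      linarith
    refine (div_le_div_of_nonneg_right (add_le_add_right this va) (by positivity)).trans_eq ?_
    field_simp
    ring
  have hprod : (va / vb - 1) * (1 - vb / va) ≤ δ * (2 * (δ * y)) :=
    mul_le_mul (by linarith) (by linarith) (by linarith) hδ
  have hprod2 : (va / vb - 1) * (1 - vb / va) = va / vb + vb / va - 2 := by
    field_simp; ring
  have hlast : δ ^ 2 * y * (va / vb) ≤ δ ^ 2 * y * (6 / 5) :=
    mul_le_mul_of_nonneg_left (by linarith) (by positivity)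
  nlinarith

/-- The divergence of the two observation laws: with `a = 1` against `a = 1 + δ`, observed up to
time `∑ h_i`, the expected log-likelihood ratio is at least `-(3/2) δ² ∑ h_i`, however many
observations there are. -/
theorem integral_log_ouRatio_ge {N : ℕ} {h : Fin N → ℝ} (hh : ∀ i, 0 < h i) {δ : ℝ}
    (hδ : 0 ≤ δ) (hδ1 : δ ≤ 1 / 5) :
    Integrable (fun x => Real.log (ouRatio 1 (1 + δ) h x)) (ouLaw 1 h) ∧
    -(3 / 2) * δ ^ 2 * ∑ i, h i ≤ ∫ x, Real.log (ouRatio 1 (1 + δ) h x) ∂(ouLaw 1 h) := by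
  have hb : 0 < 1 + δ := by linarith
  have hva := fun i => ouVar_pos one_pos (hh i)
  have hvb := fun i => ouVar_pos hb (hh i)
  set c : Fin N → ℝ := fun i => ouDecay 1 h i - ouDecay (1 + δ) h i with hc
  have hlog : ∀ ξ, Real.log (ouRatio 1 (1 + δ) h ((arInnovationEquiv (ouDecay 1 h)).symm ξ)) =
      ∑ i, (1 / 2 * (Real.log (ouVar 1 (h i)) - Real.log (ouVar (1 + δ) (h i))) -
        (ξ i + c i * arPath (ouDecay 1 h) ξ i.castSucc) ^ 2 * (2 * ouVar (1 + δ) (h i))⁻¹ +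
        ξ i ^ 2 * (2 * ouVar 1 (h i))⁻¹) := by
    intro ξ
    have e1 : ∀ i, arInnovation (ouDecay 1 h) ((arInnovationEquiv (ouDecay 1 h)).symm ξ) i = ξ i :=
      fun i => congrFun ((arInnovationEquiv (ouDecay 1 h)).apply_symm_apply ξ) i
    have e2 : ∀ i, arInnovation (ouDecay (1 + δ) h)
        ((arInnovationEquiv (ouDecay 1 h)).symm ξ) i =
        ξ i + c i * arPath (ouDecay 1 h) ξ i.castSucc := by
      intro i
      change arPath (ouDecay 1 h) ξ i.succ - _ * (Fin.cons 0
        (fun i : Fin N => arPath (ouDecay 1 h) ξ i.succ) : Fin (N + 1) → ℝ) i.castSucc = _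
      rw [cons_arPath, arPath_succ]
      simp only [hc]; ring
    rw [ouRatio, Real.log_div (ouDensity_pos hb hh _).ne' (ouDensity_pos one_pos hh _).ne',
      ouDensity, ouDensity, Real.log_prod, Real.log_prod, ← Finset.sum_sub_distrib]
    · refine Finset.sum_congr rfl fun i _ => ?_
      rw [e1, e2, log_gaussianPDFReal_zero (hva i), log_gaussianPDFReal_zero (hvb i),
        Real.log_mul (by positivity) (hva i).ne', Real.log_mul (by positivity) (hvb i).ne',
        div_eq_mul_inv, div_eq_mul_inv]
      ring
    · exact fun i _ => (gaussianPDFReal_pos _ _ _ (Real.toNNReal_pos.2 (hva i)).ne').ne'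
    · exact fun i _ => (gaussianPDFReal_pos _ _ _ (Real.toNNReal_pos.2 (hvb i)).ne').ne'
  have i1 : ∀ i, Integrable (fun ξ => (ξ i + c i * arPath (ouDecay 1 h) ξ i.castSucc) ^ 2 *
      (2 * ouVar (1 + δ) (h i))⁻¹) (ouInnovationLaw 1 h) := fun i =>
    ((memLp_two_innovation 1 h i).add
      ((memLp_two_arPath 1 h _ _).const_mul _)).integrable_sq.mul_const _
  have i2 : ∀ i, Integrable (fun ξ => ξ i ^ 2 * (2 * ouVar 1 (h i))⁻¹) (ouInnovationLaw 1 h) :=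
    fun i => (memLp_two_innovation 1 h i).integrable_sq.mul_const _
  have i0 : ∀ i, Integrable (fun _ : Fin N → ℝ =>
      1 / 2 * (Real.log (ouVar 1 (h i)) - Real.log (ouVar (1 + δ) (h i))))
      (ouInnovationLaw 1 h) := fun i => integrable_const _
  have i3 : ∀ i, Integrable (fun ξ : Fin N → ℝ =>
      1 / 2 * (Real.log (ouVar 1 (h i)) - Real.log (ouVar (1 + δ) (h i))) -
        (ξ i + c i * arPath (ouDecay 1 h) ξ i.castSucc) ^ 2 * (2 * ouVar (1 + δ) (h i))⁻¹)
      (ouInnovationLaw 1 h) := fun i => (i0 i).sub (i1 i)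
  have i4 : ∀ i, Integrable (fun ξ : Fin N → ℝ =>
      1 / 2 * (Real.log (ouVar 1 (h i)) - Real.log (ouVar (1 + δ) (h i))) -
        (ξ i + c i * arPath (ouDecay 1 h) ξ i.castSucc) ^ 2 * (2 * ouVar (1 + δ) (h i))⁻¹ +
        ξ i ^ 2 * (2 * ouVar 1 (h i))⁻¹) (ouInnovationLaw 1 h) := fun i => (i3 i).add (i2 i)
  rw [ouLaw, integrable_map_equiv, integral_map_equiv]
  simp only [Function.comp_def, hlog]
  refine ⟨integrable_finsetSum _ fun i _ => i4 i, ?_⟩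
  rw [integral_finsetSum _ fun i _ => i4 i, Finset.mul_sum]
  refine Finset.sum_le_sum fun i _ => ?_
  rw [integral_add (i3 i) (i2 i), integral_sub (i0 i) (i1 i), integral_const,
    integral_mul_const, integral_mul_const, integral_innovation_sq one_pos hh,
    integral_linear_sq one_pos hh]
  have hm := integral_arPath_sq_le one_pos hh (i.castSucc)
  have := step_log_ratio_ge hδ hδ1 (hh i) (m := ∫ ξ, arPath (ouDecay 1 h) ξ i.castSucc ^ 2
    ∂(ouInnovationLaw 1 h)) (by linarith)
  have e3 : ouVar 1 (h i) * (2 * ouVar 1 (h i))⁻¹ = 1 / 2 := by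
    have := (hva i).ne'
    field_simp
  rw [e3]
  simp only [probReal_univ, one_smul, hc, ouDecay, neg_mul, one_mul] at this ⊢
  rw [div_eq_mul_inv _ (2 * ouVar (1 + δ) (h i))] at this
  linarith

/-- Applied to a likelihood ratio, whose mean is `1`, this bounds the overlap of the two laws from
below by the expected log-likelihood ratio. -/
lemma log_le_min_one (x : ℝ) (hx : 0 < x) :
    Real.log x ≤ 3 / 2 * min 1 x + 1 / 2 * x - 3 / 2 := by
  rcases le_total 1 x with h | h
  · rw [min_eq_left h]
    have := Real.log_le_sub_one_of_pos (half_pos hx)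
    rw [Real.log_div hx.ne' two_ne_zero] at this
    linarith [Real.log_two_lt_d9]
  · rw [min_eq_right h]
    have := Real.log_le_sub_one_of_pos (mul_pos two_pos hx)
    rw [Real.log_mul two_ne_zero hx.ne'] at this
    linarith [Real.log_two_gt_d9]

/-- A likelihood ratio whose expected logarithm is close to `0` has a large overlap `∫ min(1, L)`
with the reference law. -/
lemma half_le_integral_min_one {E : Type*} [MeasurableSpace E] {μ : Measure E}
    [IsProbabilityMeasure μ] {L : E → ℝ} (hL0 : ∀ x, 0 < L x) (hL : Integrable L μ)
    (hL1 : ∫ x, L x ∂μ = 1) (hlog : Integrable (fun x => Real.log (L x)) μ)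
    (hκ : -(1 / 4) ≤ ∫ x, Real.log (L x) ∂μ) :
    ENNReal.ofReal (1 / 2) ≤ ∫⁻ x, ENNReal.ofReal (min 1 (L x)) ∂μ := by
  have hm : Integrable (fun x => min 1 (L x)) μ := (integrable_const 1).inf hL
  rw [← ofReal_integral_eq_lintegral_ofReal hm
    (ae_of_all _ fun x => le_min zero_le_one (hL0 x).le)]
  refine ENNReal.ofReal_le_ofReal ?_
  have i1 := hm.const_mul (3 / 2)
  have i2 := hL.const_mul (1 / 2)
  have := integral_mono hlog ((i1.add i2).sub (integrable_const (3 / 2)))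
    fun x => log_le_min_one (L x) (hL0 x)
  rw [integral_sub' (i1.add i2) (integrable_const _), integral_add' i1 i2, integral_const_mul,
    integral_const_mul, hL1] at this
  simp at this
  linarith

/-! ### The law of the observations and the two-point bound -/

/-- The tuple of observed states, starting with the state `0` at time `0`, that is made up of the
given coordinate paths. -/
noncomputable def obsOfPaths {d N : ℕ} (y : Fin d → Fin N → ℝ) (k : Fin (N + 1)) :
    EuclideanSpace ℝ (Fin d) :=
  WithLp.toLp 2 fun j => (Fin.cons 0 (y j) : Fin (N + 1) → ℝ) k

lemma measurable_obsOfPaths {d N : ℕ} : Measurable (obsOfPaths (d := d) (N := N)) := by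
  refine measurable_pi_lambda _ fun k => ?_
  unfold obsOfPaths
  refine (WithLp.measurable_toLp 2 _).comp (measurable_pi_lambda _ fun j => ?_)
  refine Fin.cases ?_ (fun i => ?_) k
  · simp
  · simp only [Fin.cons_succ]; fun_prop

/-- The lengths of the successive intervals between the times `t`. -/
noncomputable def timeStep {N : ℕ} (t : Fin (N + 1) → ℝ≥0) (i : Fin N) : ℝ :=
  t i.succ - t i.castSucc

lemma timeStep_pos {N : ℕ} {t : Fin (N + 1) → ℝ≥0} (ht : StrictMono t) (i : Fin N) :
    0 < timeStep t i :=
  sub_pos.2 (NNReal.coe_lt_coe.2 (ht Fin.castSucc_lt_succ))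

lemma sum_timeStep {N : ℕ} (t : Fin (N + 1) → ℝ≥0) :
    ∑ i, timeStep t i = t (Fin.last N) - t 0 := by
  have h1 := Fin.sum_univ_succ fun k => (t k : ℝ)
  have h2 := Fin.sum_univ_castSucc fun k => (t k : ℝ)
  simp only [timeStep, Finset.sum_sub_distrib]
  linarith

/-- The law of the observed states of an uncontrolled linear system with diagonal drift matrix:
the coordinates are independent Ornstein-Uhlenbeck processes. -/
theorem IsLinearSystem.map_observations {Ω : Type*} {mΩ : MeasurableSpace Ω} {d p N : ℕ}
    {P : Measure Ω} [IsProbabilityMeasure P] {𝓕 : Filtration ℝ≥0 mΩ}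
    {W : ℝ≥0 → Ω → EuclideanSpace ℝ (Fin d)} {U : ℝ≥0 → Ω → EuclideanSpace ℝ (Fin p)}
    {X : ℝ≥0 → Ω → EuclideanSpace ℝ (Fin d)} {α : Fin d → ℝ} (hα : ∀ j, 0 < α j)
    (h : IsLinearSystem (Matrix.diagonal fun j => -α j) 0 P 𝓕 W U X)
    {t : Fin (N + 1) → ℝ≥0} (ht : Monotone t) (ht0 : t 0 = 0) :
    P.map (fun ω k => X (t k) ω) =
      (Measure.pi fun j => ouLaw (α j) (timeStep t)).map obsOfPaths := by
  have hXm : ∀ s j, Measurable fun ω => X s ω j := fun s j => by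
    have := (h.state_adapted s).mono (𝓕.le s) le_rfl
    fun_prop
  have hinv := h.map_innovation hα ht
  set ξ : Ω → Fin d → Fin N → ℝ := fun ω j i => X (t i.succ) ω j -
    Real.exp (-α j * (t i.succ - t i.castSucc)) * X (t i.castSucc) ω j with hξ
  have hξm : Measurable ξ := measurable_pi_lambda _ fun j => measurable_pi_lambda _ fun i =>
    (hXm _ j).sub ((hXm _ j).const_mul _)
  have hX0 : ∀ᵐ ω ∂P, ∀ j, X 0 ω j = 0 := by
    have hW0 : ∀ᵐ ω ∂P, ∀ j, W 0 ω j = 0 := ae_all_iff.2 fun j =>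
      (h.noise.coord j).toIsPreBrownianReal.eval_zero_ae_eq_zero
    filter_upwards [hW0, h.equation] with ω h1 h2 j
    rw [h2 0]
    simp [h1 j]
  set R : (Fin d → Fin N → ℝ) → Fin d → Fin N → ℝ := fun y j =>
    (arInnovationEquiv (ouDecay (α j) (timeStep t))).symm (y j) with hR
  have hRm : Measurable R := measurable_pi_lambda _ fun j =>
    (MeasurableEquiv.measurable _).comp (measurable_pi_apply j)
  have heq : (fun ω k => X (t k) ω) =ᵐ[P] fun ω => obsOfPaths (R (ξ ω)) := by
    filter_upwards [hX0] with ω hω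
    have hcons : ∀ j, (Fin.cons 0 (fun i : Fin N => X (t i.succ) ω j) : Fin (N + 1) → ℝ) =
        fun k => X (t k) ω j := by
      intro j
      funext k
      refine Fin.cases ?_ (fun i => ?_) k
      · simp [ht0, hω j]
      · rfl
    have hRξ : ∀ j, R (ξ ω) j = fun i => X (t i.succ) ω j := by
      intro j
      rw [hR, MeasurableEquiv.symm_apply_eq]
      funext i
      change _ = _ - _ * (Fin.cons 0 (fun i : Fin N => X (t i.succ) ω j) : Fin (N + 1) → ℝ) _
      rw [hcons]
      rfl
    funext k
    ext j
    simp only [obsOfPaths, hRξ, hcons]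
  rw [Measure.map_congr heq]
  change P.map (obsOfPaths ∘ R ∘ ξ) = _
  rw [← Measure.map_map measurable_obsOfPaths (hRm.comp hξm), ← Measure.map_map hRm hξm, hinv]
  congr 1
  exact Measure.pi_map_pi (f := fun j => (arInnovationEquiv (ouDecay (α j) (timeStep t))).symm)
    fun j => (MeasurableEquiv.measurable _).aemeasurable

/-- Changing the drift of one coordinate changes the law of the independent coordinate paths by a
likelihood ratio that depends on this coordinate only. -/
lemma pi_ouLaw_update {d N : ℕ} {h : Fin N → ℝ} (hh : ∀ i, 0 < h i) (j₀ : Fin d) {b : ℝ}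
    (hb : 0 < b) :
    (Measure.pi fun j => ouLaw (if j = j₀ then b else 1) h) =
      (Measure.pi fun _ : Fin d => ouLaw 1 h).withDensity
        fun y => ENNReal.ofReal (ouRatio 1 b h (y j₀)) := by
  have := pi_withDensity_ofReal (fun _ : Fin d => ouLaw 1 h)
    (f := fun j x => if j = j₀ then ouRatio 1 b h x else 1)
    (fun j x => by
      split_ifs
      · exact (ouRatio_pos one_pos hb hh x).le
      · exact zero_le_one)
    (fun j => by
      split_ifs
      · exact integrable_ouRatio one_pos hb hh
      · exact integrable_const _)
  simp only [Finset.prod_ite_eq', Finset.mem_univ, if_true] at this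
  rw [← this]
  congr 1; funext j
  split_ifs with hj
  · exact ouLaw_eq_withDensity_ouRatio one_pos hb hh
  · simp

/-- Le Cam's two-point bound: if `g₀ + g₁ ≥ 1`, then `∫ g₀ dμ + ∫ g₁ L dμ ≥ ∫ min(1, L) dμ`. -/
lemma lintegral_min_one_le {E : Type*} [MeasurableSpace E] {μ : Measure E} {L : E → ℝ}
    (hL : Measurable L) {g₀ g₁ : E → ℝ≥0∞} (hg₀ : Measurable g₀) (hg₁ : Measurable g₁)
    (hg : ∀ x, 1 ≤ g₀ x + g₁ x) :
    ∫⁻ x, ENNReal.ofReal (min 1 (L x)) ∂μ ≤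
      ∫⁻ x, g₀ x ∂μ + ∫⁻ x, g₁ x ∂(μ.withDensity fun x => ENNReal.ofReal (L x)) := by
  rw [lintegral_withDensity_eq_lintegral_mul _ hL.ennreal_ofReal hg₁, ← lintegral_add_left hg₀]
  refine lintegral_mono fun x => ?_
  have h1 : ENNReal.ofReal (min 1 (L x)) ≤ 1 := by
    rw [← ENNReal.ofReal_one]; exact ENNReal.ofReal_le_ofReal (min_le_left _ _)
  have h2 : ENNReal.ofReal (min 1 (L x)) ≤ ENNReal.ofReal (L x) :=
    ENNReal.ofReal_le_ofReal (min_le_right _ _)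
  calc ENNReal.ofReal (min 1 (L x)) ≤ ENNReal.ofReal (min 1 (L x)) * (g₀ x + g₁ x) :=
        le_mul_of_one_le_right' (hg x)
    _ = ENNReal.ofReal (min 1 (L x)) * g₀ x + ENNReal.ofReal (min 1 (L x)) * g₁ x := mul_add _ _ _
    _ ≤ 1 * g₀ x + ENNReal.ofReal (L x) * g₁ x := by gcongr
    _ = g₀ x + ENNReal.ofReal (L x) * g₁ x := by rw [one_mul]

lemma isStableMatrix_diagonal {d : ℕ} {α : Fin d → ℝ} (hα : ∀ j, 0 < α j) :
    IsStableMatrix (Matrix.diagonal fun j => -α j) := by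
  intro z hz
  rw [Matrix.diagonal_map (map_zero _), spectrum_diagonal] at hz
  obtain ⟨j, rfl⟩ := hz
  simpa using hα j

lemma neg_one_sub_single {d : ℕ} (j₀ : Fin d) (δ : ℝ) :
    (-1 - Matrix.single j₀ j₀ δ : Matrix (Fin d) (Fin d) ℝ) =
      Matrix.diagonal fun j => -(if j = j₀ then 1 + δ else 1) := by
  ext i j
  rcases eq_or_ne i j with rfl | hij
  · rcases eq_or_ne i j₀ with rfl | hi
    · simp; ring
    · simp [hi, hi.symm]
  · have : ¬ (j₀ = i ∧ j₀ = j) := fun h => hij (h.1.symm.trans h.2)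
    simp [hij, this]

lemma le_norm_single {d : ℕ} (j₀ : Fin d) (δ : ℝ) :
    δ ≤ ‖(Matrix.single j₀ j₀ δ : Matrix (Fin d) (Fin d) ℝ)‖ := by
  have := Matrix.l2_opNorm_mulVec (Matrix.single j₀ j₀ δ : Matrix (Fin d) (Fin d) ℝ)
    (EuclideanSpace.single j₀ 1)
  rw [PiLp.norm_single, norm_one, mul_one] at this
  refine le_trans ?_ this
  have h2 := PiLp.norm_apply_le (WithLp.toLp 2 (Matrix.mulVec
    (Matrix.single j₀ j₀ δ : Matrix (Fin d) (Fin d) ℝ) (EuclideanSpace.single j₀ 1).ofLp) :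
    EuclideanSpace ℝ (Fin d)) j₀
  refine le_trans ?_ h2
  simpa using le_abs_self δ

lemma measurableSet_le_norm_sub {d : ℕ} (A : Matrix (Fin d) (Fin d) ℝ) (r : ℝ) :
    MeasurableSet {M : Matrix (Fin d) (Fin d) ℝ | r ≤ ‖M - A‖} := by
  have : BorelSpace (Matrix (Fin d) (Fin d) ℝ) :=
    inferInstanceAs (BorelSpace (Fin d → Fin d → ℝ))
  have hc : Continuous fun M : Matrix (Fin d) (Fin d) ℝ => ‖M - A‖ := by fun_prop
  exact (isClosed_le continuous_const hc).measurableSet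

/-- The law of the estimate depends on the system only through its drift matrix. -/
lemma IsLinearSystem.estimateLaw_apply {Ω : Type*} {mΩ : MeasurableSpace Ω} {d p N : ℕ}
    {P : Measure Ω} [IsProbabilityMeasure P] {𝓕 : Filtration ℝ≥0 mΩ}
    {W : ℝ≥0 → Ω → EuclideanSpace ℝ (Fin d)} {U : ℝ≥0 → Ω → EuclideanSpace ℝ (Fin p)}
    {X : ℝ≥0 → Ω → EuclideanSpace ℝ (Fin d)} {α : Fin d → ℝ} (hα : ∀ j, 0 < α j)
    (h : IsLinearSystem (Matrix.diagonal fun j => -α j) 0 P 𝓕 W U X)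
    {t : Fin (N + 1) → ℝ≥0} (ht : Monotone t) (ht0 : t 0 = 0)
    (φ : Kernel (Fin (N + 1) → EuclideanSpace ℝ (Fin d)) (Matrix (Fin d) (Fin d) ℝ))
    {S : Set (Matrix (Fin d) (Fin d) ℝ)} (hS : MeasurableSet S) :
    estimateLaw φ P X t S =
      ∫⁻ y, φ (obsOfPaths y) S ∂(Measure.pi fun j => ouLaw (α j) (timeStep t)) := by
  rw [estimateLaw, Measure.bind_apply hS φ.measurable.aemeasurable,
    h.map_observations hα ht ht0, lintegral_map (φ.measurable_coe hS) measurable_obsOfPaths]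

end

theorem theorem2 :
    ∃ c₁ c₂ : ℝ, 0 < c₁ ∧ 0 < c₂ ∧
      ∀ (d p : ℕ) (hd : 0 < d) (T : ℝ≥0), 1 ≤ T →
      ∀ (N : ℕ) (t : Fin (N + 1) → ℝ≥0), StrictMono t → t 0 = 0 → t (Fin.last N) = T →
      ∀ φ : Kernel (Fin (N + 1) → EuclideanSpace ℝ (Fin d)) (Matrix (Fin d) (Fin d) ℝ),
        IsMarkovKernel φ →
      ∃ (A : Matrix (Fin d) (Fin d) ℝ) (B : Matrix (Fin d) (Fin p) ℝ),
        (A = -1 ∨ A = -1 - Matrix.single ⟨0, hd⟩ ⟨0, hd⟩ (1 / (5 * √(T : ℝ)))) ∧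
        B = 0 ∧ IsStableMatrix A ∧
        ∀ (Ω : Type*) (mΩ : MeasurableSpace Ω) (P : Measure Ω), IsProbabilityMeasure P →
        ∀ (𝓕 : Filtration ℝ≥0 mΩ)
          (W : ℝ≥0 → Ω → EuclideanSpace ℝ (Fin d))
          (U : ℝ≥0 → Ω → EuclideanSpace ℝ (Fin p))
          (X : ℝ≥0 → Ω → EuclideanSpace ℝ (Fin d)),
          IsLinearSystem A B P 𝓕 W U X →
          ENNReal.ofReal c₂ ≤ estimateLaw φ P X t {M | c₁ / √(T : ℝ) ≤ ‖M - A‖} := by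
  refine ⟨1 / 10, 1 / 4, by norm_num, by norm_num, ?_⟩
  intro d p hd T hT N t ht ht0 htT φ hφ
  have hT1 : (1 : ℝ) ≤ √(T : ℝ) := Real.one_le_sqrt.2 (by exact_mod_cast hT)
  have hsq : √(T : ℝ) ^ 2 = T := Real.sq_sqrt T.coe_nonneg
  set δ : ℝ := 1 / (5 * √(T : ℝ)) with hδ
  have hδ0 : 0 < δ := by positivity
  have hδ1 : δ ≤ 1 / 5 := one_div_le_one_div_of_le (by norm_num) (by linarith)
  set r : ℝ := 1 / 10 / √(T : ℝ) with hr
  have hrδ : δ = r + r := by rw [hδ, hr]; field_simp; norm_num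
  set j₀ : Fin d := ⟨0, hd⟩
  set A₀ : Matrix (Fin d) (Fin d) ℝ := -1 with hA₀
  set A₁ : Matrix (Fin d) (Fin d) ℝ := -1 - Matrix.single j₀ j₀ δ with hA₁
  have hA₀' : A₀ = Matrix.diagonal fun j => -((fun _ : Fin d => (1 : ℝ)) j) := by
    ext i j; simp [A₀, Matrix.diagonal_apply, Matrix.one_apply]; split_ifs <;> simp
  have hA₁' := neg_one_sub_single j₀ δ
  have hα₀ : ∀ j : Fin d, 0 < (fun _ : Fin d => (1 : ℝ)) j := fun _ => one_pos
  have hα₁ : ∀ j, 0 < if j = j₀ then 1 + δ else 1 := fun j => by split_ifs <;> linarith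
  have hh := timeStep_pos ht
  set S₀ : Set (Matrix (Fin d) (Fin d) ℝ) := {M | r ≤ ‖M - A₀‖}
  set S₁ : Set (Matrix (Fin d) (Fin d) ℝ) := {M | r ≤ ‖M - A₁‖}
  have hS₀ : MeasurableSet S₀ := measurableSet_le_norm_sub A₀ r
  have hS₁ : MeasurableSet S₁ := measurableSet_le_norm_sub A₁ r
  -- No matrix is within `c₁ / √T` of both candidates, which are `2 c₁ / √T` apart.
  have hcover : S₀ ∪ S₁ = Set.univ := by
    refine Set.eq_univ_of_forall fun M => ?_
    by_contra hM
    rw [Set.mem_union, not_or] at hM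
    have h0 : ‖M - A₀‖ < r := not_le.1 hM.1
    have h1 : ‖M - A₁‖ < r := not_le.1 hM.2
    have h2 : Matrix.single j₀ j₀ δ = (M - A₁) - (M - A₀) := by rw [hA₁, hA₀]; abel
    have h3 := le_norm_single j₀ δ
    rw [h2] at h3
    linarith [norm_sub_le (M - A₁) (M - A₀)]
  have hcov1 : ∀ y : Fin d → Fin N → ℝ, 1 ≤ φ (obsOfPaths y) S₀ + φ (obsOfPaths y) S₁ := by
    intro y
    rw [← measure_univ (μ := φ (obsOfPaths y)), ← hcover]
    exact measure_union_le _ _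
  set μ₀ := Measure.pi fun _ : Fin d => ouLaw 1 (timeStep t)
  set μ₁ := Measure.pi fun j : Fin d => ouLaw (if j = j₀ then 1 + δ else 1) (timeStep t)
  have hlog := integral_log_ouRatio_ge hh hδ0.le hδ1
  have hκ : -(1 / 4) ≤
      ∫ x, Real.log (ouRatio 1 (1 + δ) (timeStep t) x) ∂(ouLaw 1 (timeStep t)) := by
    refine le_trans ?_ hlog.2
    have : δ ^ 2 * T = 1 / 25 := by
      rw [hδ, div_pow, mul_pow, hsq]
      have : (T : ℝ) ≠ 0 := by rw [← hsq]; positivity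
      field_simp; norm_num
    rw [sum_timeStep, ht0, htT, NNReal.coe_zero, sub_zero, mul_assoc, this]
    norm_num
  have hsum : ENNReal.ofReal (1 / 2) ≤
      ∫⁻ y, φ (obsOfPaths y) S₀ ∂μ₀ + ∫⁻ y, φ (obsOfPaths y) S₁ ∂μ₁ := by
    refine (half_le_integral_min_one (fun x => ouRatio_pos one_pos (by linarith) hh x)
      (integrable_ouRatio one_pos (by linarith) hh) (integral_ouRatio one_pos (by linarith) hh)
      hlog.1 hκ).trans ?_
    rw [← (measurePreserving_eval (fun _ : Fin d => ouLaw 1 (timeStep t)) j₀).lintegral_comp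
      (measurable_const.min (measurable_ouRatio _ _ _)).ennreal_ofReal]
    have := lintegral_min_one_le (μ := μ₀)
      ((measurable_ouRatio 1 (1 + δ) (timeStep t)).comp (measurable_pi_apply j₀))
      ((φ.measurable_coe hS₀).comp measurable_obsOfPaths)
      ((φ.measurable_coe hS₁).comp measurable_obsOfPaths) hcov1
    simp only [μ₁]
    rw [pi_ouLaw_update hh j₀ (by linarith)]
    exact this
  -- The right-hand sides depend only on the estimator and the matrices, so the matrix can be chosen
  -- before the process.
  by_cases hV : ENNReal.ofReal (1 / 4) ≤ ∫⁻ y, φ (obsOfPaths y) S₀ ∂μ₀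
  · refine ⟨A₀, 0, Or.inl rfl, rfl, hA₀' ▸ isStableMatrix_diagonal hα₀, ?_⟩
    intro Ω mΩ P hP 𝓕 W U X hX
    rw [hA₀'] at hX
    rwa [hX.estimateLaw_apply hα₀ ht.monotone ht0 φ hS₀]
  · refine ⟨A₁, 0, Or.inr rfl, rfl, ?_, ?_⟩
    · rw [hA₁, hA₁']; exact isStableMatrix_diagonal hα₁
    intro Ω mΩ P hP 𝓕 W U X hX
    rw [hA₁, hA₁'] at hX
    rw [hX.estimateLaw_apply hα₁ ht.monotone ht0 φ hS₁]
    by_contra hlt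
    have := ENNReal.add_lt_add (not_le.1 hV) (not_le.1 hlt)
    rw [← ENNReal.ofReal_add (by norm_num) (by norm_num)] at this
    norm_num at this hsum
    exact absurd hsum (not_le.2 this)
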